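/- Let $b\ge 3$ and $m\ge 2$ be integers and $D_b=\{0,1,\dots,b-1\}$. For a sequence $\omega=\omega^0\omega^1\omega^2\ldots$ of words $\omega^k=\omega^k_1\ldots\omega^k_m\in D_b^m$, let $$K^\omega=\Big\{\sum_{i=1}^\infty d_i b^{-i} : d_i\in D_b \text{ for all } i\ge 1,\ d_{k+1}d_{k+2}\ldots d_{k+m}\neq\omega^k \text{ for all } k\ge 0\Big\}.$$ Call $\omega$ *progressively overlapping* if $\omega^k_1\ldots\omega^k_{m-j}=\omega^{k-j}_{j+1}\ldots\omega^{k-j}_m$ for all $k\ge1$ and all $1\le j\le\min\{k,m-1\}$, and *totally distinct* if $\omega^k_1\ldots\omega^k_{m-j}\ne\omega^{k-j}_{j+1}\ldots\omega^{k-j}_m$ for all such $k$ and $j$. A compact set $F\subset\mathbb R$ is *$s$-Ahlfors regular* if there is $c\ge1$ such that $c^{-1}r^s\le\mathcal H^s(F\cap B(x,r))\le c\,r^s$ for all $0<r<1$ and $x\in F$, where $\mathcal H^s$ is the $s$-dimensional Hausdorff measure and $B(x,r)$ is the closed ball. A *Pisot number* is an algebraic integer greater than $1$ all of whose other conjugates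 have modulus less than $1$. **Theorem 1.4.** (i) The equation $x^m-(b-1)(x^{m-1}+x^{m-2}+\cdots+x+1)=0$ has exactly one root $\lambda$ in $(b-1,b)$, and $\lambda$ is a Pisot number. If $\omega$ is progressively overlapping, then $K^\omega$ is compact and $\frac{\log\lambda}{\log b}$-Ahlfors regular. (ii) The equation $x^m-bx^{m-1}+1=0$ has exactly one root $\eta$ in $(b-1,b)$, and $\eta$ is a Pisot number. If $\omega$ is totally distinct, then $K^\omega$ is compact and $\frac{\log\eta}{\log b}$-Ahlfors regular. -/

import Mathlib

open scoped ENNReal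

/-- The left shift iterated `k` times on infinite sequences of digits. A sequence
`d₁ d₂ d₃ …` is the function with `d i = dᵢ₊₁`. -/
def shiftSeq {b : ℕ} (k : ℕ) (d : ℕ → Fin b) : ℕ → Fin b := fun i => d (i + k)

/-- The cylinder set of a finite word `w` of length `n`: all sequences that start with `w`. -/
def cylinderSet {b n : ℕ} (w : Fin n → Fin b) : Set (ℕ → Fin b) :=
  {d | ∀ i : Fin n, d i = w i}

/-- The symbolic survivor set for the moving holes given by the cylinders of `ω⁰, ω¹, …`. -/
def symbolicSurvivorSet {b m : ℕ} (ω : ℕ → Fin m → Fin b) : Set (ℕ → Fin b) :=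
  {d | ∀ k : ℕ, shiftSeq k d ∉ cylinderSet (ω k)}

/-- The survivor set `K^ω`: the image of the symbolic survivor set under the base `b` projection
`(dᵢ)ᵢ ↦ ∑ dᵢ b⁻ⁱ` (the sum over `i ≥ 1`). -/
noncomputable def survivorSet {b m : ℕ} (ω : ℕ → Fin m → Fin b) : Set ℝ :=
  (fun d : ℕ → Fin b => Real.ofDigits d) '' symbolicSurvivorSet ω

/-- The prefix of length `m - j` of the word `ω^k` equals the suffix of length `m - j` of the
word `ω^(k-j)` (letters are numbered from `0`). Only used for `j ≤ k` and `j < m`. -/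
def PrefixEqSuffix {b m : ℕ} (ω : ℕ → Fin m → Fin b) (k j : ℕ) : Prop :=
  ∀ (i : ℕ) (h : i + j < m), ω k ⟨i, by omega⟩ = ω (k - j) ⟨i + j, h⟩

/-- `ω` is progressively overlapping at position `k`. -/
def ProgressivelyOverlappingAt {b m : ℕ} (ω : ℕ → Fin m → Fin b) (k : ℕ) : Prop :=
  ∀ j : ℕ, 1 ≤ j → j ≤ min k (m - 1) → PrefixEqSuffix ω k j

/-- `ω` is progressively overlapping. -/
def ProgressivelyOverlapping {b m : ℕ} (ω : ℕ → Fin m → Fin b) : Prop :=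
  ∀ k : ℕ, 1 ≤ k → ProgressivelyOverlappingAt ω k

/-- `ω` is totally distinct at position `k`. -/
def TotallyDistinctAt {b m : ℕ} (ω : ℕ → Fin m → Fin b) (k : ℕ) : Prop :=
  ∀ j : ℕ, 1 ≤ j → j ≤ min k (m - 1) → ¬ PrefixEqSuffix ω k j

/-- `ω` is totally distinct. -/
def TotallyDistinct {b m : ℕ} (ω : ℕ → Fin m → Fin b) : Prop :=
  ∀ k : ℕ, 1 ≤ k → TotallyDistinctAt ω k

/-- `F` is `s`-Ahlfors regular: `F` is compact and, for some `c ≥ 1`, the `s`-dimensional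
Hausdorff measure of `F ∩ B(x, r)` lies between `c⁻¹ r ^ s` and `c r ^ s` for all `x ∈ F` and
`0 < r < 1`. -/
def IsAhlforsRegular {X : Type*} [MetricSpace X] [MeasurableSpace X] [BorelSpace X]
    (s : ℝ) (F : Set X) : Prop :=
  IsCompact F ∧ ∃ c : ℝ, 1 ≤ c ∧ ∀ r : ℝ, 0 < r → r < 1 → ∀ x ∈ F,
    ENNReal.ofReal (c⁻¹ * r ^ s) ≤
        MeasureTheory.Measure.hausdorffMeasure s (F ∩ Metric.closedBall x r) ∧
      MeasureTheory.Measure.hausdorffMeasure s (F ∩ Metric.closedBall x r) ≤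
        ENNReal.ofReal (c * r ^ s)

/-- A Pisot number: a real algebraic integer greater than `1` all of whose other conjugates
(complex roots of its minimal polynomial) have modulus less than `1`. -/
def IsPisot (x : ℝ) : Prop :=
  IsIntegral ℤ x ∧ 1 < x ∧
    ∀ z : ℂ, Polynomial.aeval z (minpoly ℚ x) = 0 → z ≠ (x : ℂ) → ‖z‖ < 1

/-! Regularity follows from a weight `H` on words that vanishes on words meeting a hole, lies
between `κ > 0` and `1` on the others, and sums to `l * H w` over the one-letter extensions of `w`.
Then `l⁻ⁿ H(w)` is a consistent mass on cylinders of length `n`, comparable to `l⁻ⁿ = (b⁻ⁿ)ˢ` with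
`s = log l / log b`. The mass distribution principle and the covers by cylinders give the two bounds
(`IsWordMass.isAhlforsRegular_image`).

The weight is explicit. A word ending with the first `j` letters of a hole may lose survivors `m -
j` steps later, so `H(w) = 1 - ∑ θ l^(-(m-j))` over the matched `j` with `1 ≤ j < m`, where `θ` is
the value of this formula at a word that has just completed a hole. One letter prolongs a given
match, and a new match starts at every step, whence the condition `b - θ l^(-(m-1)) = l`
(`sum_survivorMass_cons`). The overlap hypotheses make `θ` constant: at a complete hole, progressive
overlap forces all shorter matches and `θ = (b-1)/l`, while total distinctness forbids them and `θ =
1`. These values yield the two polynomials.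

For the Pisot property, both equations reduce to `x^N - b x^(N-1) + a = 0` with `0 < a ≤ b - 1`. An
equality case of the triangle inequality for reciprocals of roots leaves only `l` and `1` outside
the open unit disc. -/

/-! ### Roots of the two equations and the Pisot property -/

theorem eq_or_eq_one_of_trinomial_root {a b l : ℝ} {N : ℕ} (hN : 2 ≤ N) (ha : 0 < a)
    (hab : a ≤ b - 1) (hl : 1 < l) (hroot : l ^ N + a = b * l ^ (N - 1)) {z : ℂ}
    (hz : 1 ≤ ‖z‖) (hzroot : z ^ N + a = b * z ^ (N - 1)) : z = l ∨ z = 1 := by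
  obtain ⟨n, rfl⟩ : ∃ n, N = n + 2 := ⟨N - 2, by omega⟩
  simp only [Nat.add_succ_sub_one] at hroot hzroot
  have hl0 : l ≠ 0 := by positivity
  have hz0 : z ≠ 0 := norm_pos_iff.1 (by linarith)
  set u := z⁻¹ with hu
  set v := l⁻¹ with hv
  have hv0 : 0 < v := by positivity
  have hv1 : v < 1 := inv_lt_one_of_one_lt₀ hl
  have hu1 : ‖u‖ ≤ 1 := by
    rw [hu, norm_inv]
    exact inv_le_one_of_one_le₀ hz
  have hbv : b * v = 1 + a * v ^ (n + 2) := by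
    rw [hv, inv_pow]
    field_simp
    linear_combination -l * hroot
  have hbu : b * u = 1 + a * u ^ (n + 2) := by
    rw [hu, inv_pow]
    field_simp
    linear_combination -z * hzroot
  by_cases huv : u = v
  · left
    rw [← inv_inv z, ← hu, huv, hv]
    simp
  right
  -- Subtract the equations of `u` and `v` and divide by `u - v`. Since `‖u‖ ≤ 1`, the real part of
  -- the left side is at most `a ∑ vⁱ ≤ b`; equality then forces `Re u = 1`.
  have hsum : (a : ℂ) * ∑ i ∈ Finset.range (n + 2), u ^ i * (v : ℂ) ^ (n + 2 - 1 - i) = b := by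
    have h := (Commute.all u (v : ℂ)).geom_sum₂_mul (n + 2)
    have hbv' : (b : ℂ) * v = 1 + a * v ^ (n + 2) := by exact_mod_cast hbv
    apply mul_right_cancel₀ (sub_ne_zero.2 huv)
    rw [mul_assoc, h]
    linear_combination hbv' - hbu
  have hre : a * ∑ i ∈ Finset.range (n + 2), (u ^ i).re * v ^ (n + 2 - 1 - i) = b := by
    have h := congrArg Complex.re hsum
    rw [Complex.re_ofReal_mul, Complex.re_sum, Complex.ofReal_re] at h
    rw [← h]
    congr 1
    refine Finset.sum_congr rfl fun i _ => ?_
    rw [← Complex.ofReal_pow, Complex.re_mul_ofReal]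
  have hle : ∀ i, (u ^ i).re ≤ 1 := fun i =>
    (Complex.re_le_norm _).trans (by rw [norm_pow]; exact pow_le_one₀ (norm_nonneg _) hu1)
  -- From `hbv`, `a (1 - v^(n+2)) = a + 1 - b v ≤ b (1 - v)`.
  have hgeom : a * ∑ i ∈ Finset.range (n + 2), v ^ (n + 2 - 1 - i) ≤ b := by
    rw [Finset.sum_range_reflect (fun i => v ^ i)]
    have h := geom_sum_mul v (n + 2)
    by_contra! hc
    nlinarith
  have hu_re : u.re = 1 := by
    by_contra hne
    have hlt : u.re < 1 := lt_of_le_of_ne (by simpa using hle 1) hne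
    have : ∑ i ∈ Finset.range (n + 2), (u ^ i).re * v ^ (n + 2 - 1 - i) <
        ∑ i ∈ Finset.range (n + 2), v ^ (n + 2 - 1 - i) := by
      refine Finset.sum_lt_sum (fun i _ => ?_) ⟨1, by simp, ?_⟩
      · exact mul_le_of_le_one_left (by positivity) (hle i)
      · rw [pow_one]
        exact mul_lt_of_lt_one_left (by positivity) hlt
    nlinarith
  have hu_one : u = 1 := by
    have h1 : u.re ^ 2 + u.im ^ 2 ≤ 1 := by
      have := Complex.sq_norm u
      rw [Complex.normSq_apply] at this
      nlinarith [norm_nonneg u]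
    apply Complex.ext
    · simpa using hu_re
    · rw [hu_re] at h1
      simp only [Complex.one_im]
      nlinarith
  rw [← inv_inv z, ← hu, hu_one, inv_one]

theorem exists_trinomial_root {a b : ℝ} {N : ℕ} (hN : 2 ≤ N) (ha : 0 < a)
    (hab : a < (b - 1) ^ (N - 1)) :
    ∃ l : ℝ, b - 1 < l ∧ l < b ∧ l ^ N + a = b * l ^ (N - 1) := by
  obtain ⟨n, rfl⟩ : ∃ n, N = n + 1 := ⟨N - 1, by omega⟩
  simp only [Nat.add_succ_sub_one, Nat.add_zero] at *
  have hcont : ContinuousOn (fun x : ℝ => x ^ (n + 1) + a - b * x ^ n) (Set.Icc (b - 1) b) := by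
    fun_prop
  obtain ⟨l, ⟨h1, h2⟩, h3⟩ := intermediate_value_Ioo (by linarith : b - 1 ≤ b) hcont
    (show (0 : ℝ) ∈ _ from ⟨by rw [pow_succ]; nlinarith, by rw [pow_succ]; nlinarith⟩)
  exact ⟨l, h1, h2, by simpa [sub_eq_zero] using h3⟩

/-- The minimal polynomial divides `p` over `ℚ`, so irreducibility of `p` is not needed. -/
theorem isPisot_of_monic {x : ℝ} {p : Polynomial ℤ} (hp : p.Monic) (hx : 1 < x)
    (hpx : Polynomial.aeval x p = 0)
    (hroots : ∀ z : ℂ, Polynomial.aeval z p = 0 → 1 ≤ ‖z‖ → z = x) : IsPisot x := by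
  refine ⟨⟨p, hp, hpx⟩, hx, fun z hz hzx => ?_⟩
  by_contra! h
  refine hzx (hroots z ?_ h)
  have hdvd : minpoly ℚ x ∣ p.map (algebraMap ℤ ℚ) :=
    minpoly.dvd ℚ x (by rwa [Polynomial.aeval_map_algebraMap])
  rw [← Polynomial.aeval_map_algebraMap ℚ]
  exact Polynomial.aeval_eq_zero_of_dvd_aeval_eq_zero hdvd hz

/-- Brings the first equation to trinomial form with `a = b - 1`, at the price of the extra root
`1`. -/
theorem pow_sub_geom_sum_mul {R : Type*} [CommRing R] (b x : R) (m : ℕ) :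
    (x ^ m - (b - 1) * ∑ i ∈ Finset.range m, x ^ i) * (x - 1) =
      x ^ (m + 1) + (b - 1) - b * x ^ m := by
  have := geom_sum_mul x m
  rw [sub_mul, mul_assoc, this]
  ring

theorem exists_geom_pisot_root {b m : ℕ} (hb : 3 ≤ b) (hm : 2 ≤ m) :
    ∃ l : ℝ, (b : ℝ) - 1 < l ∧ l < b ∧
      l ^ m - ((b : ℝ) - 1) * ∑ i ∈ Finset.range m, l ^ i = 0 ∧
      IsPisot l ∧
      ∀ x : ℝ, (b : ℝ) - 1 < x → x < b →
        x ^ m - ((b : ℝ) - 1) * ∑ i ∈ Finset.range m, x ^ i = 0 → x = l := by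
  have hb' : (3 : ℝ) ≤ b := by exact_mod_cast hb
  obtain ⟨l, h1, h2, h3⟩ := exists_trinomial_root (a := (b : ℝ) - 1) (b := b) (N := m + 1)
    (by omega) (by linarith) (by
      simpa using lt_self_pow₀ (by linarith : (1 : ℝ) < b - 1) (by omega : 1 < m))
  have hroots : ∀ z : ℂ, z ^ m - ((b : ℂ) - 1) * ∑ i ∈ Finset.range m, z ^ i = 0 →
      1 ≤ ‖z‖ → z = l := by
    intro z hz hz1
    rcases eq_or_eq_one_of_trinomial_root (by omega) (by linarith : (0 : ℝ) < b - 1) le_rfl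
      (by linarith) h3 hz1 (by
        have := pow_sub_geom_sum_mul (b : ℂ) z m
        rw [hz, zero_mul] at this
        push_cast
        linear_combination -this) with h | rfl
    · exact h
    · exfalso
      simp only [one_pow, Finset.sum_const, Finset.card_range, nsmul_eq_mul, mul_one] at hz
      have hz' : (1 : ℝ) - (b - 1) * m = 0 := by exact_mod_cast hz
      have : (2 : ℝ) ≤ m := by exact_mod_cast hm
      nlinarith
  have hl : l ^ m - ((b : ℝ) - 1) * ∑ i ∈ Finset.range m, l ^ i = 0 := by
    have := pow_sub_geom_sum_mul (b : ℝ) l m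
    rw [Nat.add_sub_cancel] at h3
    rw [h3, sub_self] at this
    exact (mul_eq_zero.1 this).resolve_right (by linarith)
  refine ⟨l, h1, h2, hl, ?_, fun x hx _ hxr => ?_⟩
  · refine isPisot_of_monic
      (p := Polynomial.X ^ m - Polynomial.C ((b : ℤ) - 1) * ∑ i ∈ Finset.range m, Polynomial.X ^ i)
      ?_ (by linarith) (by simpa using hl) fun z hz => hroots z (by simpa using hz)
    apply Polynomial.monic_X_pow_sub
    rw [Polynomial.degree_lt_iff_coeff_zero]
    intro k hk
    rw [Polynomial.coeff_C_mul, Polynomial.finsetSum_coeff, Finset.sum_eq_zero, mul_zero]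
    intro i hi
    rw [Polynomial.coeff_X_pow, if_neg]
    have := Finset.mem_range.1 hi
    omega
  · have := hroots x (by exact_mod_cast hxr) (by
      rw [Complex.norm_real, Real.norm_eq_abs]
      exact le_trans (by linarith) (le_abs_self x))
    exact_mod_cast this

theorem exists_trinomial_pisot_root {b m : ℕ} (hb : 3 ≤ b) (hm : 2 ≤ m) :
    ∃ l : ℝ, (b : ℝ) - 1 < l ∧ l < b ∧
      l ^ m - (b : ℝ) * l ^ (m - 1) + 1 = 0 ∧
      IsPisot l ∧
      ∀ x : ℝ, (b : ℝ) - 1 < x → x < b →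
        x ^ m - (b : ℝ) * x ^ (m - 1) + 1 = 0 → x = l := by
  have hb' : (3 : ℝ) ≤ b := by exact_mod_cast hb
  obtain ⟨l, h1, h2, h3⟩ := exists_trinomial_root (a := 1) (b := b) hm one_pos
    (one_lt_pow₀ (by linarith : (1 : ℝ) < b - 1) (by omega))
  have hroots : ∀ z : ℂ, z ^ m - (b : ℂ) * z ^ (m - 1) + 1 = 0 → 1 ≤ ‖z‖ → z = l := by
    intro z hz hz1
    rcases eq_or_eq_one_of_trinomial_root hm (one_pos : (0 : ℝ) < 1) (by linarith : (1 : ℝ) ≤ b - 1)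
      (by linarith) h3 hz1 (by
        push_cast
        linear_combination hz) with h | rfl
    · exact h
    · exfalso
      have hz' : (1 : ℝ) - b + 1 = 0 := by
        simp only [one_pow, mul_one] at hz
        exact_mod_cast hz
      linarith
  refine ⟨l, h1, h2, by linarith, ?_, fun x hx _ hxr => ?_⟩
  · refine isPisot_of_monic
      (p := Polynomial.X ^ m - (Polynomial.C (b : ℤ) * Polynomial.X ^ (m - 1) - 1))
      ?_ (by linarith) (by simp; linarith) fun z hz => hroots z (by
        simp only [map_sub, map_mul, map_pow, Polynomial.aeval_X, map_one, map_natCast] at hz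
        linear_combination hz)
    apply Polynomial.monic_X_pow_sub
    refine (Polynomial.degree_sub_le _ _).trans_lt (max_lt ?_ ?_)
    · refine (Polynomial.degree_C_mul_X_pow_le _ _).trans_lt ?_
      exact_mod_cast (by omega : m - 1 < m)
    · rw [Polynomial.degree_one]
      exact_mod_cast (by omega : 0 < m)
  · have := hroots x (by exact_mod_cast hxr) (by
      rw [Complex.norm_real, Real.norm_eq_abs]
      exact le_trans (by linarith) (le_abs_self x))
    exact_mod_cast this

/-! ### Digit words and base `b` expansions -/

/-- The first `n` digits of a sequence, the most recent digit at the head of the list. -/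
def prefixWord {b : ℕ} (d : ℕ → Fin b) : ℕ → List (Fin b)
  | 0 => []
  | n + 1 => d n :: prefixWord d n

section Words

variable {b : ℕ}

@[simp] theorem length_prefixWord (d : ℕ → Fin b) (n : ℕ) : (prefixWord d n).length = n := by
  induction n with
  | zero => rfl
  | succ n ih => simp [prefixWord, ih]

theorem prefixWord_congr {d e : ℕ → Fin b} {n : ℕ} (h : ∀ i < n, d i = e i) :
    prefixWord d n = prefixWord e n := by
  induction n with
  | zero => rfl
  | succ n ih => simp [prefixWord, h n (by omega), ih fun i hi => h i (by omega)]

theorem eq_of_prefixWord_eq {d e : ℕ → Fin b} {n : ℕ} (h : prefixWord d n = prefixWord e n) :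
    ∀ i < n, d i = e i := by
  induction n with
  | zero => simp
  | succ n ih =>
    simp only [prefixWord, List.cons.injEq] at h
    intro i hi
    rcases Nat.lt_succ_iff_lt_or_eq.1 hi with hi | rfl
    exacts [ih h.2 i hi, h.1]

theorem exists_prefixWord_eq (hb : 0 < b) (w : List (Fin b)) :
    ∃ d : ℕ → Fin b, prefixWord d w.length = w := by
  induction w with
  | nil => exact ⟨fun _ => ⟨0, hb⟩, rfl⟩
  | cons a w ih =>
    obtain ⟨d, hd⟩ := ih
    refine ⟨Function.update d w.length a, ?_⟩
    simp only [List.length_cons, prefixWord, Function.update_self, List.cons.injEq, true_and]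
    conv_rhs => rw [← hd]
    exact prefixWord_congr fun i hi => Function.update_of_ne (by omega) _ _

theorem exists_prefixWord_add_eq (d : ℕ → Fin b) (n p : ℕ) :
    ∃ v : Fin p → Fin b, prefixWord d (n + p) = List.ofFn v ++ prefixWord d n := by
  induction p with
  | zero => exact ⟨Fin.elim0, by simp⟩
  | succ p ih =>
    obtain ⟨v, hv⟩ := ih
    exact ⟨Fin.cons (d (n + p)) v, by simp [prefixWord, hv, List.ofFn_succ]⟩

/-- The integer with a given base `b` expansion. -/
def wordVal (w : List (Fin b)) : ℕ := Nat.ofDigits b (w.map Fin.val)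

theorem wordVal_injOn (hb : 1 < b) (n : ℕ) :
    Set.InjOn (wordVal (b := b)) {w | w.length = n} := by
  intro v hv w hw h
  have := Nat.ofDigits_inj_of_len_eq hb (L1 := v.map Fin.val) (L2 := w.map Fin.val)
    (by simp only [List.length_map]; exact hv.trans hw.symm) (by simp) (by simp) h
  exact List.map_injective_iff.2 Fin.val_injective this

theorem pow_mul_ofDigits_eq (hb : 0 < b) (d : ℕ → Fin b) (n : ℕ) :
    (b : ℝ) ^ n * Real.ofDigits d =
      wordVal (prefixWord d n) + Real.ofDigits fun i => d (i + n) := by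
  have hb' : (b : ℝ) ≠ 0 := by positivity
  have key : (b : ℝ) ^ n * ∑ i ∈ Finset.range n, Real.ofDigitsTerm d i =
      wordVal (prefixWord d n) := by
    induction n with
    | zero => simp [wordVal, prefixWord]
    | succ n ih =>
      rw [Finset.sum_range_succ, mul_add, pow_succ', mul_assoc, ih]
      simp only [wordVal, prefixWord, List.map_cons, Nat.ofDigits_cons, Real.ofDigitsTerm]
      push_cast
      field_simp
      ring
  rw [Real.ofDigits_eq_sum_add_ofDigits d n, mul_add, key, ← mul_assoc,
    mul_inv_cancel₀ (by positivity), one_mul]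

/-- Scaled by `bⁿ`, a point of `T` is the integer coded by its prefix plus a tail in `[0, 1]`, and
it lies within `1` of `bⁿ x`. At most five integers remain, and each codes at most one word of
length `n`. -/
theorem exists_finset_prefixWord_mem (hb : 1 < b) (x : ℝ) (n : ℕ) {T : Set ℝ}
    (hT : ∀ y ∈ T, |y - x| ≤ ((b : ℝ) ^ n)⁻¹) :
    ∃ W : Finset (List (Fin b)), W.card ≤ 5 ∧ (∀ w ∈ W, w.length = n) ∧
      ∀ d : ℕ → Fin b, Real.ofDigits d ∈ T → prefixWord d n ∈ W := by
  classical
  set A : Set (List (Fin b)) := {w | ∃ d, prefixWord d n = w ∧ Real.ofDigits d ∈ T} with hA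
  have hAlen : A ⊆ {w | w.length = n} := by
    rintro _ ⟨d, rfl, -⟩
    simp
  set f : List (Fin b) → ℤ := fun w => wordVal w with hf
  have hinj : Set.InjOn f A := fun v hv w hw h =>
    wordVal_injOn hb n (hAlen hv) (hAlen hw) (by simpa [hf] using h)
  set k := ⌊(b : ℝ) ^ n * x⌋ with hk
  have hmaps : Set.MapsTo f A (Finset.Icc (k - 2) (k + 2) : Finset ℤ) := by
    rintro _ ⟨d, rfl, hd⟩
    have h1 := pow_mul_ofDigits_eq (by omega) d n
    have h2 := Real.ofDigits_nonneg fun i => d (i + n)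
    have h3 := Real.ofDigits_le_one fun i => d (i + n)
    have h4 := Int.floor_le ((b : ℝ) ^ n * x)
    have h5 := Int.lt_floor_add_one ((b : ℝ) ^ n * x)
    have hpos : (0 : ℝ) < (b : ℝ) ^ n := by positivity
    have h6 : |(b : ℝ) ^ n * Real.ofDigits d - b ^ n * x| ≤ 1 := by
      rw [← mul_sub, abs_mul, abs_of_pos hpos, ← mul_inv_cancel₀ hpos.ne']
      exact mul_le_mul_of_nonneg_left (hT _ hd) hpos.le
    rw [abs_le] at h6
    rw [← hk] at h4 h5
    simp only [hf, Finset.coe_Icc, Set.mem_Icc]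
    constructor
    · have : (k : ℝ) - 3 < (wordVal (prefixWord d n) : ℤ) := by push_cast; linarith
      have : k - 3 < (wordVal (prefixWord d n) : ℤ) := by exact_mod_cast this
      omega
    · have : ((wordVal (prefixWord d n) : ℤ) : ℝ) < k + 3 := by push_cast; linarith
      have : (wordVal (prefixWord d n) : ℤ) < k + 3 := by exact_mod_cast this
      omega
  have hfin : A.Finite := Set.Finite.of_injOn hmaps hinj (Finset.finite_toSet _)
  refine ⟨hfin.toFinset, ?_, fun w hw => hAlen (hfin.mem_toFinset.1 hw),
    fun d hd => hfin.mem_toFinset.2 ⟨d, rfl, hd⟩⟩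
  have := Finset.card_le_card_of_injOn (s := hfin.toFinset)
    (t := Finset.Icc (k - 2) (k + 2)) f (by simpa using hmaps)
    (by simpa using hinj)
  rw [Int.card_Icc] at this
  omega

/-- As the latest digit is the head, initial segments are list suffixes, and at most one letter
continues `w` towards `v`. -/
theorem sum_ite_cons_isSuffix_le (v w : List (Fin b)) (c : ℝ≥0∞) [∀ u, Decidable (u <:+ v)] :
    (∑ a, if a :: w <:+ v then c else 0) ≤ if w <:+ v then c else 0 := by
  by_cases h : ∃ a, a :: w <:+ v
  · obtain ⟨a, ha⟩ := h
    rw [if_pos ((List.suffix_cons a w).trans ha), Finset.sum_eq_single a]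
    · simp [ha]
    · intro a' _ hne
      rw [if_neg]
      intro ha'
      have := (List.suffix_of_suffix_length_le ha' ha (by simp)).eq_of_length (by simp)
      simp only [List.cons.injEq, and_true] at this
      exact hne this
    · simp
  · push Not at h
    simp [h]

end Words

/-! ### Masses on the tree of words -/

/-- A nonnegative function on words over `b` letters, multiplied by `l` when summed over the
one-letter extensions of a word, and bounded away from `0` where it does not vanish. -/
structure IsWordMass {b : ℕ} (l κ : ℝ) (H : List (Fin b) → ℝ) : Prop where
  sum_cons : ∀ w, ∑ a, H (a :: w) = l * H w
  eq_zero_or_le : ∀ w, H w = 0 ∨ κ ≤ H w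
  le_one : ∀ w, H w ≤ 1

/-- The sequences all of whose prefixes have positive mass. -/
def massSupport {b : ℕ} (H : List (Fin b) → ℝ) : Set (ℕ → Fin b) :=
  {d | ∀ n, H (prefixWord d n) ≠ 0}

/-- The points with an expansion in the support of `H` that starts with `w`. -/
def massCell {b : ℕ} (H : List (Fin b) → ℝ) (w : List (Fin b)) : Set ℝ :=
  Real.ofDigits '' {d | d ∈ massSupport H ∧ prefixWord d w.length = w}

/-- The mass of the cylinder of `w`. -/
noncomputable def cylMass {b : ℕ} (l : ℝ) (H : List (Fin b) → ℝ) (w : List (Fin b)) : ℝ≥0∞ :=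
  ENNReal.ofReal ((l ^ w.length)⁻¹ * H w)

namespace IsWordMass

variable {b : ℕ} {l κ : ℝ} {H : List (Fin b) → ℝ}

theorem nonneg (h : IsWordMass l κ H) (hκ : 0 < κ) (w : List (Fin b)) : 0 ≤ H w := by
  rcases h.eq_zero_or_le w with h | h <;> linarith

theorem cylMass_le (h : IsWordMass l κ H) (hl : 0 < l) (w : List (Fin b)) :
    cylMass l H w ≤ ENNReal.ofReal (l ^ w.length)⁻¹ :=
  ENNReal.ofReal_le_ofReal (mul_le_of_le_one_right (by positivity) (h.le_one w))

theorem sum_cylMass_cons (h : IsWordMass l κ H) (hl : 0 < l) (hκ : 0 < κ) (w : List (Fin b)) :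
    ∑ a, cylMass l H (a :: w) = cylMass l H w := by
  simp only [cylMass]
  rw [← ENNReal.ofReal_sum_of_nonneg fun a _ => mul_nonneg (by positivity) (h.nonneg hκ _)]
  simp only [List.length_cons]
  rw [← Finset.mul_sum, h.sum_cons, pow_succ]
  congr 1
  field_simp

theorem ne_zero_of_cons (h : IsWordMass l κ H) (hκ : 0 < κ) {a : Fin b}
    {w : List (Fin b)} (ha : H (a :: w) ≠ 0) : H w ≠ 0 := by
  intro h0
  have := h.sum_cons w
  rw [h0, mul_zero, Finset.sum_eq_zero_iff_of_nonneg fun _ _ => h.nonneg hκ _] at this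
  exact ha (this a (Finset.mem_univ a))

theorem ne_zero_of_prefixWord (h : IsWordMass l κ H) (hκ : 0 < κ) {d : ℕ → Fin b} {k n : ℕ}
    (hkn : k ≤ n) (hn : H (prefixWord d n) ≠ 0) : H (prefixWord d k) ≠ 0 := by
  induction n, hkn using Nat.le_induction with
  | base => exact hn
  | succ n _ ih => exact ih (h.ne_zero_of_cons hκ hn)

/-- A superadditive function that is smaller than the mass at a word stays smaller along some
infinite path through that word. -/
theorem exists_path (h : IsWordMass l κ H) (hl : 0 < l) (hκ : 0 < κ)
    {φ : List (Fin b) → ℝ≥0∞} (hφ : ∀ w, ∑ a, φ (a :: w) ≤ φ w) {d₀ : ℕ → Fin b} {n : ℕ}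
    (hlt : φ (prefixWord d₀ n) < cylMass l H (prefixWord d₀ n)) :
    ∃ d ∈ massSupport H, prefixWord d n = prefixWord d₀ n ∧
      ∀ k ≥ n, φ (prefixWord d k) < cylMass l H (prefixWord d k) := by
  -- The mass is additive and `φ` superadditive over children, so failure at every child would give
  -- failure at `w`.
  have step : ∀ w, φ w < cylMass l H w → ∃ a, φ (a :: w) < cylMass l H (a :: w) := by
    intro w hw
    by_contra! hc
    have := Finset.sum_le_sum fun a (_ : a ∈ Finset.univ) => hc a
    rw [h.sum_cylMass_cons hl hκ] at this
    exact absurd (this.trans (hφ w)) (not_le.2 hw)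
  have step' : ∀ w, ∃ a, φ w < cylMass l H w → φ (a :: w) < cylMass l H (a :: w) := by
    intro w
    by_cases hw : φ w < cylMass l H w
    · obtain ⟨a, ha⟩ := step w hw
      exact ⟨a, fun _ => ha⟩
    · exact ⟨d₀ 0, fun h => absurd h hw⟩
  choose next hnext using step'
  let W : ℕ → List (Fin b) := Nat.rec (prefixWord d₀ n) fun _ w => next w :: w
  let d : ℕ → Fin b := fun i => if i < n then d₀ i else next (W (i - n))
  have h0 : prefixWord d n = prefixWord d₀ n :=
    prefixWord_congr fun i hi => if_pos hi
  have hW : ∀ k, prefixWord d (n + k) = W k := by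
    intro k
    induction k with
    | zero => exact h0
    | succ k ih =>
      change d (n + k) :: prefixWord d (n + k) = next (W k) :: W k
      rw [ih]
      simp [d]
  have hWlt : ∀ k, φ (W k) < cylMass l H (W k) := by
    intro k
    induction k with
    | zero => exact hlt
    | succ k ih => exact hnext _ ih
  have hpath : ∀ k ≥ n, φ (prefixWord d k) < cylMass l H (prefixWord d k) := by
    intro k hk
    obtain ⟨j, rfl⟩ := Nat.exists_eq_add_of_le hk
    rw [hW]
    exact hWlt j
  refine ⟨d, fun k => ?_, h0, hpath⟩
  refine h.ne_zero_of_prefixWord hκ (le_max_left k n) fun hz => ?_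
  have := hpath (max k n) (le_max_right k n)
  rw [cylMass, hz] at this
  simp at this

/-- Countable subadditivity of the mass with respect to covers by cylinders. -/
theorem cylMass_le_tsum (h : IsWordMass l κ H) (hl : 0 < l) (hκ : 0 < κ) {d₀ : ℕ → Fin b} {n : ℕ}
    {W : ℕ → Finset (List (Fin b))}
    (hcov : ∀ d ∈ massSupport H, prefixWord d n = prefixWord d₀ n →
      ∃ i, ∃ k ≥ n, prefixWord d k ∈ W i) :
    cylMass l H (prefixWord d₀ n) ≤ ∑' i, ∑ v ∈ W i, cylMass l H v := by
  classical
  by_contra! hlt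
  -- `φ w` is the total mass of the covering words that extend `w`. Along the path on which it stays
  -- below the mass, no covering word can occur.
  set φ : List (Fin b) → ℝ≥0∞ := fun w =>
    ∑' i, ∑ v ∈ W i, if w <:+ v then cylMass l H v else 0 with hφ
  have hsuper : ∀ w, ∑ a, φ (a :: w) ≤ φ w := by
    intro w
    simp only [hφ]
    rw [← Summable.tsum_finsetSum fun _ _ => ENNReal.summable]
    refine ENNReal.tsum_le_tsum fun i => ?_
    rw [Finset.sum_comm]
    exact Finset.sum_le_sum fun v _ => sum_ite_cons_isSuffix_le v w _
  obtain ⟨d, hd, hdn, hpath⟩ := h.exists_path hl hκ hsuper (d₀ := d₀) (n := n)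
    (lt_of_le_of_lt (ENNReal.tsum_le_tsum fun i => Finset.sum_le_sum fun v _ => by
      split_ifs <;> simp) hlt)
  obtain ⟨i, k, hk, hmem⟩ := hcov d hd hdn
  refine absurd (hpath k hk) (not_lt.2 ?_)
  refine le_trans ?_ (ENNReal.le_tsum i)
  refine le_trans ?_ (Finset.single_le_sum (fun _ _ => zero_le) hmem)
  simp

end IsWordMass

/-! ### Hausdorff measure bounds and Ahlfors regularity -/

theorem rpow_log_div_log {b : ℕ} (hb : 1 < b) {l : ℝ} (hl : 0 < l) :
    (b : ℝ) ^ (Real.log l / Real.log b) = l := by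
  have hb' : (1 : ℝ) < b := by exact_mod_cast hb
  have := Real.log_pos hb'
  rw [Real.rpow_def_of_pos (by linarith), mul_div_cancel₀ _ this.ne', Real.exp_log hl]

theorem inv_pow_rpow_log_div_log {b : ℕ} (hb : 1 < b) {l : ℝ} (hl : 0 < l) (n : ℕ) :
    (((b : ℝ) ^ n)⁻¹) ^ (Real.log l / Real.log b) = (l ^ n)⁻¹ := by
  rw [Real.inv_rpow (by positivity), ← Real.rpow_natCast, ← Real.rpow_mul (by positivity),
    mul_comm, Real.rpow_mul (by positivity), rpow_log_div_log hb hl, Real.rpow_natCast]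

theorem log_div_log_pos {b : ℕ} (hb : 1 < b) {l : ℝ} (hl : 1 < l) :
    0 < Real.log l / Real.log b :=
  div_pos (Real.log_pos hl) (Real.log_pos (by exact_mod_cast hb))

theorem exists_inv_pow_lt_le {b : ℕ} (hb : 1 < b) {r : ℝ} (hr : 0 < r) (hr1 : r ≤ 1) :
    ∃ n : ℕ, ((b : ℝ) ^ (n + 1))⁻¹ < r ∧ r ≤ ((b : ℝ) ^ n)⁻¹ := by
  have hb' : (1 : ℝ) < b := by exact_mod_cast hb
  simpa only [inv_pow] using exists_nat_pow_near_of_lt_one hr hr1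
    (inv_pos.2 (by linarith : (0 : ℝ) < b)) (inv_lt_one_of_one_lt₀ hb')

theorem ediam_massCell_le {b : ℕ} (H : List (Fin b) → ℝ) (w : List (Fin b)) :
    Metric.ediam (massCell H w) ≤ ENNReal.ofReal ((b : ℝ) ^ w.length)⁻¹ := by
  refine Metric.ediam_le ?_
  rintro _ ⟨d, ⟨-, hd⟩, rfl⟩ _ ⟨e, ⟨-, he⟩, rfl⟩
  rw [edist_dist, Real.dist_eq]
  exact ENNReal.ofReal_le_ofReal
    (Real.abs_ofDigits_sub_ofDigits_le (eq_of_prefixWord_eq (hd.trans he.symm)))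

namespace IsWordMass

variable {b : ℕ} {l κ : ℝ} {H : List (Fin b) → ℝ}

theorem exists_words_of_ediam_le (h : IsWordMass l κ H) (hb : 1 < b) (hl : 1 < l) {T : Set ℝ}
    {k : ℕ} (hT : Metric.ediam T ≤ ENNReal.ofReal ((b : ℝ) ^ k)⁻¹) :
    ∃ W : Finset (List (Fin b)), (∀ d : ℕ → Fin b, Real.ofDigits d ∈ T → prefixWord d k ∈ W) ∧
      ∑ v ∈ W, cylMass l H v ≤ ENNReal.ofReal (5 * (l ^ k)⁻¹) := by
  rcases T.eq_empty_or_nonempty with rfl | ⟨x, hx⟩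
  · exact ⟨∅, by simp, by simp⟩
  obtain ⟨W, hcard, hlen, hW⟩ := exists_finset_prefixWord_mem hb x k (T := T) (by
    intro y hy
    have := (Metric.edist_le_ediam_of_mem hy hx).trans hT
    rwa [edist_dist, ENNReal.ofReal_le_ofReal_iff (by positivity), Real.dist_eq] at this)
  refine ⟨W, hW, ?_⟩
  have hsum : ∑ v ∈ W, cylMass l H v ≤ W.card • ENNReal.ofReal (l ^ k)⁻¹ :=
    Finset.sum_le_card_nsmul _ _ _ fun v hv => by
      have := h.cylMass_le (by linarith) v
      rwa [hlen v hv] at this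
  refine hsum.trans ?_
  rw [ENNReal.ofReal_mul (by norm_num), nsmul_eq_mul]
  gcongr
  rw [ENNReal.ofReal_ofNat]
  exact_mod_cast hcard

/-- If `b^(-(k+1)) < diam T ≤ b^(-k)`, five words of length `k` cost at most `5 l^(-k) ≤ 5 l (diam
T)^s`. A set of diameter zero has no such `k`; a deep enough level then costs less than `ε`. -/
theorem exists_words_cover (h : IsWordMass l κ H) (hb : 1 < b) (hl : 1 < l) {T : Set ℝ}
    {n : ℕ} (hT : Metric.ediam T ≤ ENNReal.ofReal ((b : ℝ) ^ n)⁻¹) {ε : ℝ≥0∞} (hε : ε ≠ 0) :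
    ∃ W : Finset (List (Fin b)),
      (∀ d : ℕ → Fin b, Real.ofDigits d ∈ T → ∃ k ≥ n, prefixWord d k ∈ W) ∧
      ∑ v ∈ W, cylMass l H v ≤ ENNReal.ofReal (5 * l) *
        (⨆ _ : T.Nonempty, Metric.ediam T ^ (Real.log l / Real.log b)) + ε := by
  rcases T.eq_empty_or_nonempty with rfl | hne
  · exact ⟨∅, by simp, by simp⟩
  have hb' : (1 : ℝ) < b := by exact_mod_cast hb
  rw [iSup_pos hne]
  rcases eq_or_ne (Metric.ediam T) 0 with h0 | h0
  · have hlim : Filter.Tendsto (fun k : ℕ => ENNReal.ofReal (5 * (l ^ k)⁻¹)) Filter.atTop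
        (nhds 0) := by
      rw [← ENNReal.ofReal_zero]
      refine ENNReal.tendsto_ofReal ?_
      have := (tendsto_pow_atTop_nhds_zero_of_lt_one (inv_nonneg.2 (by linarith : 0 ≤ l))
        (inv_lt_one_of_one_lt₀ hl)).const_mul 5
      simpa [inv_pow] using this
    obtain ⟨k, hk, hkn⟩ := ((hlim.eventually (gt_mem_nhds (pos_iff_ne_zero.2 hε))).and
      (Filter.eventually_ge_atTop n)).exists
    obtain ⟨W, hW, hsum⟩ := h.exists_words_of_ediam_le hb hl (T := T) (k := k) (by simp [h0])
    exact ⟨W, fun d hd => ⟨k, hkn, hW d hd⟩, (hsum.trans hk.le).trans le_add_self⟩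
  · have htop : Metric.ediam T ≠ ∞ := ne_top_of_le_ne_top ENNReal.ofReal_ne_top hT
    obtain ⟨δ, hδ⟩ : ∃ δ, (Metric.ediam T).toReal = δ := ⟨_, rfl⟩
    have hTδ : Metric.ediam T = ENNReal.ofReal δ := by rw [← hδ, ENNReal.ofReal_toReal htop]
    have hδ0 : 0 < δ := hδ ▸ ENNReal.toReal_pos h0 htop
    rw [hTδ] at hT ⊢
    rw [ENNReal.ofReal_le_ofReal_iff (by positivity)] at hT
    obtain ⟨k, hk1, hk2⟩ := exists_inv_pow_lt_le hb hδ0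
      (hT.trans (inv_le_one_of_one_le₀ (one_le_pow₀ hb'.le)))
    have hkn : n ≤ k := by
      by_contra! hc
      have : ((b : ℝ) ^ n)⁻¹ ≤ ((b : ℝ) ^ (k + 1))⁻¹ := by gcongr; exacts [hb'.le, hc]
      linarith
    obtain ⟨W, hW, hsum⟩ := h.exists_words_of_ediam_le hb hl (T := T) (k := k)
      (hTδ ▸ ENNReal.ofReal_le_ofReal hk2)
    refine ⟨W, fun d hd => ⟨k, hkn, hW d hd⟩, (hsum.trans ?_).trans le_self_add⟩
    rw [ENNReal.ofReal_rpow_of_pos hδ0, ← ENNReal.ofReal_mul (by linarith)]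
    refine ENNReal.ofReal_le_ofReal ?_
    have := Real.rpow_le_rpow (by positivity) hk1.le (log_div_log_pos hb hl).le
    rw [inv_pow_rpow_log_div_log hb (by linarith)] at this
    calc 5 * (l ^ k)⁻¹ = 5 * l * (l ^ (k + 1))⁻¹ := by rw [pow_succ]; field_simp
      _ ≤ _ := by gcongr

/-- The mass distribution principle without constructing a measure: each cover by small sets is
replaced by a cover by cylinders, where `cylMass_le_tsum` applies. -/
theorem cylMass_le_hausdorffMeasure (h : IsWordMass l κ H) (hb : 1 < b) (hl : 1 < l) (hκ : 0 < κ)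
    (d₀ : ℕ → Fin b) (n : ℕ) :
    cylMass l H (prefixWord d₀ n) ≤ ENNReal.ofReal (5 * l) *
      MeasureTheory.Measure.hausdorffMeasure (Real.log l / Real.log b)
        (massCell H (prefixWord d₀ n)) := by
  set C := ENNReal.ofReal (5 * l) with hC
  have hC0 : C ≠ 0 := by simp only [hC, ne_eq, ENNReal.ofReal_eq_zero, not_le]; linarith
  have hCt : C ≠ ∞ := ENNReal.ofReal_ne_top
  rw [← ENNReal.div_le_iff' hC0 hCt, MeasureTheory.Measure.hausdorffMeasure_apply]
  -- Restricting to diameters at most `b⁻ⁿ` makes every covering word at least `n` letters long.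
  refine le_iSup₂_of_le (ENNReal.ofReal ((b : ℝ) ^ n)⁻¹)
    (ENNReal.ofReal_pos.2 (by positivity)) ?_
  refine le_iInf fun t => le_iInf₂ fun hcov hdiam => ?_
  rw [ENNReal.div_le_iff' hC0 hCt]
  refine ENNReal.le_of_forall_pos_le_add fun ε hε _ => ?_
  obtain ⟨ε', hε', hsum⟩ := ENNReal.exists_pos_sum_of_countable' (ENNReal.coe_pos.2 hε).ne' ℕ
  choose W hW hWsum using fun i => h.exists_words_cover hb hl (hdiam i) (hε' i).ne'
  refine (h.cylMass_le_tsum (by linarith) hκ (W := W) fun d hd hdn => ?_).trans ?_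
  · obtain ⟨i, hi⟩ := Set.mem_iUnion.1 (hcov ⟨d, ⟨hd, by simpa using hdn⟩, rfl⟩)
    exact ⟨i, hW i d hi⟩
  · refine (ENNReal.tsum_le_tsum hWsum).trans ?_
    rw [ENNReal.tsum_add, ENNReal.tsum_mul_left]
    gcongr

theorem sum_ofFn_append (h : IsWordMass l κ H) (w : List (Fin b)) (p : ℕ) :
    ∑ v : Fin p → Fin b, H (List.ofFn v ++ w) = l ^ p * H w := by
  induction p with
  | zero => simp
  | succ p ih =>
    rw [← (Fin.consEquiv fun _ : Fin (p + 1) => Fin b).sum_comp, Fintype.sum_prod_type,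
      Finset.sum_comm]
    simp only [Fin.consEquiv, Equiv.coe_fn_mk, List.ofFn_cons, List.cons_append, h.sum_cons]
    rw [← Finset.mul_sum, ih, pow_succ']
    ring

/-- On nonempty cells `κ⁻¹ * H w ≥ 1`. The factor `H w` is kept because it sums exactly over
extensions. -/
theorem ediam_massCell_rpow_le (h : IsWordMass l κ H) (hb : 1 < b) (hl : 1 < l) (hκ : 0 < κ)
    (w : List (Fin b)) :
    Metric.ediam (massCell H w) ^ (Real.log l / Real.log b) ≤
      ENNReal.ofReal (κ⁻¹ * (l ^ w.length)⁻¹ * H w) := by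
  have hs := log_div_log_pos hb hl
  rcases h.eq_zero_or_le w with h0 | h0
  · have : massCell H w = ∅ := by
      rw [massCell, Set.image_eq_empty, Set.eq_empty_iff_forall_notMem]
      rintro d ⟨hd, hw⟩
      exact hd w.length (by rw [hw, h0])
    simp [this, hs]
  · refine (ENNReal.rpow_le_rpow (ediam_massCell_le H w) hs.le).trans ?_
    rw [ENNReal.ofReal_rpow_of_pos (by positivity), inv_pow_rpow_log_div_log hb (by linarith)]
    refine ENNReal.ofReal_le_ofReal ?_
    rw [mul_right_comm]
    refine le_mul_of_one_le_left (by positivity) ?_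
    rw [← inv_mul_cancel₀ hκ.ne']
    gcongr

theorem hausdorffMeasure_massCell_le (h : IsWordMass l κ H) (hb : 1 < b) (hl : 1 < l) (hκ : 0 < κ)
    (w : List (Fin b)) :
    MeasureTheory.Measure.hausdorffMeasure (Real.log l / Real.log b) (massCell H w) ≤
      ENNReal.ofReal (κ⁻¹ * (l ^ w.length)⁻¹) := by
  have hb' : (1 : ℝ) < b := by exact_mod_cast hb
  refine (MeasureTheory.Measure.hausdorffMeasure_le_liminf_sum (l := Filter.atTop)
    (ι := fun p : ℕ => Fin p → Fin b) _ _ (fun p => ENNReal.ofReal ((b : ℝ) ^ p)⁻¹) ?_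
    (fun p v => massCell H (List.ofFn v ++ w)) ?_ ?_).trans ?_
  · rw [← ENNReal.ofReal_zero]
    refine ENNReal.tendsto_ofReal ?_
    simpa only [inv_pow] using tendsto_pow_atTop_nhds_zero_of_lt_one
      (inv_nonneg.2 (by linarith : (0 : ℝ) ≤ b)) (inv_lt_one_of_one_lt₀ hb')
  · refine Filter.Eventually.of_forall fun p v => (ediam_massCell_le H _).trans (ENNReal.ofReal_le_ofReal ?_)
    gcongr
    · exact hb'.le
    · simp
  · refine Filter.Eventually.of_forall fun p => ?_
    rintro _ ⟨d, ⟨hd, hdw⟩, rfl⟩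
    obtain ⟨v, hv⟩ := exists_prefixWord_add_eq d w.length p
    rw [hdw] at hv
    refine Set.mem_iUnion.2 ⟨v, d, ⟨hd, ?_⟩, rfl⟩
    rw [← hv, length_prefixWord]
  · refine Filter.liminf_le_of_frequently_le' (Filter.Frequently.of_forall fun p => ?_)
    refine (Finset.sum_le_sum fun v _ => h.ediam_massCell_rpow_le hb hl hκ _).trans ?_
    rw [← ENNReal.ofReal_sum_of_nonneg fun v _ =>
      mul_nonneg (by positivity) (h.nonneg hκ _)]
    refine ENNReal.ofReal_le_ofReal ?_
    simp only [List.length_append, List.length_ofFn]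
    rw [← Finset.mul_sum, h.sum_ofFn_append]
    calc κ⁻¹ * (l ^ (p + w.length))⁻¹ * (l ^ p * H w) = κ⁻¹ * (l ^ w.length)⁻¹ * H w := by
          rw [pow_add]; field_simp
      _ ≤ _ := mul_le_of_le_one_right (by positivity) (h.le_one w)

theorem isAhlforsRegular_image (h : IsWordMass l κ H) (hb : 1 < b) (hl : 1 < l) (hκ : 0 < κ)
    (hκ1 : κ ≤ 1) (hclosed : IsClosed (massSupport H)) :
    IsAhlforsRegular (Real.log l / Real.log b) (Real.ofDigits '' massSupport H) := by
  have hb' : (1 : ℝ) < b := by exact_mod_cast hb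
  have hs := log_div_log_pos hb hl
  -- The lower bound loses `5 l` from the mass comparison, `κ⁻¹` from the weight and one `l` from
  -- rounding `r` to a power of `b`. The upper bound needs only `5 l κ⁻¹`.
  refine ⟨hclosed.isCompact.image Real.continuous_ofDigits, 5 * l ^ 2 * κ⁻¹, ?_, ?_⟩
  · have : 1 ≤ κ⁻¹ := (one_le_inv₀ hκ).2 hκ1
    nlinarith
  rintro r hr hr1 _ ⟨d₀, hd₀, rfl⟩
  obtain ⟨n, hn1, hn2⟩ := exists_inv_pow_lt_le hb hr hr1.le
  have hrs1 := Real.rpow_le_rpow (by positivity) hn1.le hs.le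
  have hrs2 := Real.rpow_le_rpow hr.le hn2 hs.le
  rw [inv_pow_rpow_log_div_log hb (by linarith)] at hrs1 hrs2
  constructor
  · have hsub : massCell H (prefixWord d₀ (n + 1)) ⊆
        Real.ofDigits '' massSupport H ∩ Metric.closedBall (Real.ofDigits d₀) r := by
      rintro _ ⟨d, ⟨hd, hdw⟩, rfl⟩
      refine ⟨⟨d, hd, rfl⟩, ?_⟩
      rw [length_prefixWord] at hdw
      rw [Metric.mem_closedBall, Real.dist_eq]
      exact (Real.abs_ofDigits_sub_ofDigits_le (eq_of_prefixWord_eq hdw)).trans hn1.le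
    refine le_trans ?_ (MeasureTheory.measure_mono hsub)
    have hlow := h.cylMass_le_hausdorffMeasure hb hl hκ d₀ (n + 1)
    rw [← ENNReal.div_le_iff' (by simp only [ne_eq, ENNReal.ofReal_eq_zero, not_le]; linarith)
      ENNReal.ofReal_ne_top, cylMass, ← ENNReal.ofReal_div_of_pos (by linarith),
      length_prefixWord] at hlow
    refine (ENNReal.ofReal_le_ofReal ?_).trans hlow
    have hH : κ ≤ H (prefixWord d₀ (n + 1)) := (h.eq_zero_or_le _).resolve_left (hd₀ _)
    calc (5 * l ^ 2 * κ⁻¹)⁻¹ * r ^ (Real.log l / Real.log b)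
        ≤ (5 * l ^ 2 * κ⁻¹)⁻¹ * (l ^ n)⁻¹ := by gcongr
      _ = (l ^ (n + 1))⁻¹ * κ / (5 * l) := by rw [pow_succ l n]; field_simp
      _ ≤ _ := by gcongr
  · obtain ⟨W, hcard, hlen, hW⟩ := exists_finset_prefixWord_mem hb (Real.ofDigits d₀) n
      (T := Metric.closedBall (Real.ofDigits d₀) r) (fun y hy => by
        rw [Metric.mem_closedBall, Real.dist_eq] at hy
        exact hy.trans hn2)
    have hsub : Real.ofDigits '' massSupport H ∩ Metric.closedBall (Real.ofDigits d₀) r ⊆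
        ⋃ v ∈ W, massCell H v := by
      rintro _ ⟨⟨d, hd, rfl⟩, hball⟩
      refine Set.mem_iUnion₂.2 ⟨_, hW d hball, d, ⟨hd, by simp⟩, rfl⟩
    refine (MeasureTheory.measure_mono hsub).trans
      ((MeasureTheory.measure_biUnion_finset_le _ _).trans ?_)
    refine (Finset.sum_le_card_nsmul _ _ (ENNReal.ofReal (κ⁻¹ * (l ^ n)⁻¹)) fun v hv => by
      have := h.hausdorffMeasure_massCell_le hb hl hκ v
      rwa [hlen v hv] at this).trans ?_
    rw [nsmul_eq_mul, ← ENNReal.ofReal_natCast, ← ENNReal.ofReal_mul (by positivity)]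
    refine ENNReal.ofReal_le_ofReal ?_
    have hcard' : (W.card : ℝ) ≤ 5 := by exact_mod_cast hcard
    calc (W.card : ℝ) * (κ⁻¹ * (l ^ n)⁻¹) ≤ 5 * (κ⁻¹ * (l ^ n)⁻¹) := by gcongr
      _ = 5 * l * κ⁻¹ * (l ^ (n + 1))⁻¹ := by rw [pow_succ]; field_simp
      _ ≤ 5 * l ^ 2 * κ⁻¹ * r ^ (Real.log l / Real.log b) := by
        gcongr
        nlinarith

end IsWordMass

/-! ### The survivor mass for moving holes -/

/-- The last `j` digits of a word of length `n` are the first `j` digits of `ω^(n-j)`. -/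
def PartialMatch {b m : ℕ} (ω : ℕ → Fin m → Fin b) : ℕ → List (Fin b) → Prop
  | 0, _ => True
  | _ + 1, [] => False
  | j + 1, a :: w => PartialMatch ω j w ∧ ∃ h : j < m, a = ω (w.length - j) ⟨j, h⟩

/-- No prefix of the word ends with a complete hole. -/
def AvoidsHoles {b m : ℕ} (ω : ℕ → Fin m → Fin b) : List (Fin b) → Prop
  | [] => True
  | a :: w => AvoidsHoles ω w ∧ ¬ PartialMatch ω m (a :: w)

open Classical in
/-- The expected proportion of survivors among the extensions of a word that avoids the holes. -/
noncomputable def survivalWeight {b m : ℕ} (ω : ℕ → Fin m → Fin b) (l θ : ℝ)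
    (w : List (Fin b)) : ℝ :=
  1 - ∑ i ∈ Finset.range (m - 1),
    if PartialMatch ω (i + 1) w then θ * (l ^ (m - 1 - i))⁻¹ else 0

open Classical in
/-- The survival weight, set to `0` on the words that meet a hole. -/
noncomputable def survivorMass {b m : ℕ} (ω : ℕ → Fin m → Fin b) (l θ : ℝ)
    (w : List (Fin b)) : ℝ :=
  if AvoidsHoles ω w then survivalWeight ω l θ w else 0

section Holes

variable {b m : ℕ} {ω : ℕ → Fin m → Fin b}

theorem PartialMatch.le_length {j : ℕ} {w : List (Fin b)} (h : PartialMatch ω j w) :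
    j ≤ w.length := by
  induction w generalizing j with
  | nil => cases j with
    | zero => simp
    | succ j => exact h.elim
  | cons a w ih => cases j with
    | zero => simp
    | succ j => simpa using ih h.1

theorem partialMatch_prefixWord_iff {d : ℕ → Fin b} {j k : ℕ} (hj : j ≤ m) :
    PartialMatch ω j (prefixWord d (k + j)) ↔
      ∀ i, ∀ hi : i < j, d (k + i) = ω k ⟨i, hi.trans_le hj⟩ := by
  induction j with
  | zero => simp [PartialMatch]
  | succ j ih =>
    rw [← Nat.add_assoc]
    simp only [prefixWord, PartialMatch]
    rw [ih (by omega)]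
    simp only [length_prefixWord, Nat.add_sub_cancel]
    constructor
    · rintro ⟨h1, _, h2⟩ i hi
      rcases Nat.lt_succ_iff_lt_or_eq.1 hi with hi | rfl
      exacts [h1 i hi, h2]
    · exact fun h => ⟨fun i hi => h i (by omega), hj, h j (by omega)⟩

theorem sum_partialMatch_cons [∀ v : List (Fin b), ∀ j, Decidable (PartialMatch ω j v)] {i : ℕ}
    (hi : i < m) (w : List (Fin b)) (c : ℝ) :
    (∑ a, if PartialMatch ω (i + 1) (a :: w) then c else 0) =
      if PartialMatch ω i w then c else 0 := by
  have : ∀ a, PartialMatch ω (i + 1) (a :: w) ↔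
      PartialMatch ω i w ∧ a = ω (w.length - i) ⟨i, hi⟩ := by
    simp [PartialMatch, hi]
  simp only [this]
  by_cases h : PartialMatch ω i w <;> simp [h]

theorem mem_symbolicSurvivorSet_iff (hm : 0 < m) {d : ℕ → Fin b} :
    d ∈ symbolicSurvivorSet ω ↔ ∀ n, AvoidsHoles ω (prefixWord d n) := by
  have hmatch : ∀ k, shiftSeq k d ∈ cylinderSet (ω k) ↔
      PartialMatch ω m (prefixWord d (k + m)) := by
    intro k
    rw [partialMatch_prefixWord_iff le_rfl]
    simp only [cylinderSet, shiftSeq, Set.mem_ofPred_eq]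
    exact ⟨fun h i hi => by rw [Nat.add_comm]; exact h ⟨i, hi⟩,
      fun h i => by rw [Nat.add_comm]; exact h i i.2⟩
  simp only [symbolicSurvivorSet, Set.mem_ofPred_eq, hmatch]
  constructor
  · intro h n
    induction n with
    | zero => trivial
    | succ n ih =>
      refine ⟨ih, fun hf => ?_⟩
      have hle := hf.le_length
      simp only [List.length_cons, length_prefixWord] at hle
      apply h (n + 1 - m)
      rwa [Nat.sub_add_cancel hle]
  · intro h k
    obtain ⟨n, hn⟩ : ∃ n, k + m = n + 1 := ⟨k + m - 1, by omega⟩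
    rw [hn]
    exact (h (n + 1)).2

theorem isClosed_symbolicSurvivorSet (ω : ℕ → Fin m → Fin b) :
    IsClosed (symbolicSurvivorSet ω) := by
  have : symbolicSurvivorSet ω = ⋂ k, (⋂ i : Fin m, {d : ℕ → Fin b | d (i + k) = ω k i})ᶜ := by
    ext d
    simp [symbolicSurvivorSet, cylinderSet, shiftSeq]
  rw [this]
  refine isClosed_iInter fun k => IsOpen.isClosed_compl ?_
  refine isOpen_iInter_of_finite fun i => ?_
  exact IsOpen.preimage (continuous_apply (A := fun _ => Fin b) ((i : ℕ) + k))
    (isOpen_discrete {ω k i})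

/-- Multiplying by `l` shifts each penalty from distance `m - j` to `m - j - 1`, just as the letter
prolonging the match does. The new matches of length `1` account for `b - l`, and completed holes
remove exactly `θ`. -/
theorem sum_survivorMass_cons {N : ℕ} {ω : ℕ → Fin (N + 2) → Fin b} {l θ : ℝ} (hl : 0 < l)
    (hθ : b - θ * (l ^ (N + 1))⁻¹ = l)
    (hfull : ∀ w, PartialMatch ω (N + 2) w → survivalWeight ω l θ w = θ) (w : List (Fin b)) :
    ∑ a, survivorMass ω l θ (a :: w) = l * survivorMass ω l θ w := by
  classical
  by_cases hw : AvoidsHoles ω w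
  swap
  · simp [survivorMass, AvoidsHoles, hw]
  have hsplit : ∀ a, survivorMass ω l θ (a :: w) = survivalWeight ω l θ (a :: w) -
      if PartialMatch ω (N + 2) (a :: w) then θ else 0 := by
    intro a
    by_cases ha : PartialMatch ω (N + 2) (a :: w)
    · simp [survivorMass, AvoidsHoles, ha, hfull]
    · simp [survivorMass, AvoidsHoles, ha, hw]
  simp only [hsplit, Finset.sum_sub_distrib]
  rw [sum_partialMatch_cons (by omega), survivorMass, if_pos hw]
  simp only [survivalWeight, Finset.sum_sub_distrib]
  rw [Finset.sum_comm, Finset.sum_congr rfl fun i hi => sum_partialMatch_cons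
    (by have := Finset.mem_range.1 hi; omega) w _]
  simp only [Nat.add_succ_sub_one, Finset.sum_const, Finset.card_univ, Fintype.card_fin,
    nsmul_eq_mul, mul_one]
  -- Split off the empty match on the left and the match of length `N + 1` on the right; the
  -- remaining terms pair up.
  rw [Finset.sum_range_succ', Finset.sum_range_succ, mul_sub, mul_add, Finset.mul_sum]
  have hstep : ∀ i ∈ Finset.range N,
      l * (if PartialMatch ω (i + 1) w then θ * (l ^ (N + 1 - i))⁻¹ else 0) =
        if PartialMatch ω (i + 1) w then θ * (l ^ (N + 1 - (i + 1)))⁻¹ else 0 := by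
    intro i hi
    have hi := Finset.mem_range.1 hi
    rw [mul_ite, mul_zero, show N + 1 - i = N + 1 - (i + 1) + 1 by omega, pow_succ]
    congr 1
    field_simp
  rw [Finset.sum_congr rfl hstep]
  rw [if_pos (show PartialMatch ω 0 w from trivial)]
  simp only [Nat.sub_zero, Nat.add_sub_cancel_left, pow_one]
  have hlast : l * (if PartialMatch ω (N + 1) w then θ * l⁻¹ else 0) =
      if PartialMatch ω (N + 1) w then θ else 0 := by
    rw [mul_ite, mul_zero]
    congr 1
    field_simp
  rw [hlast]
  linarith

/-- The bound `κ` covers the worst case, in which all partial matches occur at once. -/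
theorem isWordMass_survivorMass {ω : ℕ → Fin m → Fin b} (hm : 2 ≤ m) {l θ κ : ℝ} (hl : 0 < l)
    (hθ0 : 0 < θ) (hθ : b - θ * (l ^ (m - 1))⁻¹ = l)
    (hfull : ∀ w, PartialMatch ω m w → survivalWeight ω l θ w = θ)
    (hκ : κ ≤ 1 - ∑ i ∈ Finset.range (m - 1), θ * (l ^ (m - 1 - i))⁻¹) :
    IsWordMass l κ (survivorMass ω l θ) ∧
      ∀ w, AvoidsHoles ω w → κ ≤ survivorMass ω l θ w := by
  classical
  obtain ⟨N, rfl⟩ : ∃ N, m = N + 2 := ⟨m - 2, by omega⟩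
  have hlow : ∀ w, AvoidsHoles ω w → κ ≤ survivorMass ω l θ w := by
    intro w hw
    rw [survivorMass, if_pos hw, survivalWeight]
    refine hκ.trans (sub_le_sub_left (Finset.sum_le_sum fun i _ => ?_) 1)
    split_ifs
    exacts [le_rfl, by positivity]
  refine ⟨⟨sum_survivorMass_cons hl hθ hfull, fun w => ?_, fun w => ?_⟩, hlow⟩
  · by_cases hw : AvoidsHoles ω w
    · exact Or.inr (hlow w hw)
    · exact Or.inl (if_neg hw)
  · rw [survivorMass]
    split_ifs
    · rw [survivalWeight, sub_le_self_iff]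
      refine Finset.sum_nonneg fun i _ => ?_
      split_ifs
      exacts [by positivity, le_rfl]
    · norm_num

theorem isAhlforsRegular_survivorSet (hb : 1 < b) (hm : 2 ≤ m) {l θ κ : ℝ} (hl : 1 < l)
    (hθ0 : 0 < θ) (hθ : b - θ * (l ^ (m - 1))⁻¹ = l)
    (hfull : ∀ w, PartialMatch ω m w → survivalWeight ω l θ w = θ) (hκ0 : 0 < κ)
    (hκ : κ ≤ 1 - ∑ i ∈ Finset.range (m - 1), θ * (l ^ (m - 1 - i))⁻¹) :
    IsAhlforsRegular (Real.log l / Real.log b) (survivorSet ω) := by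
  obtain ⟨hmass, hlow⟩ := isWordMass_survivorMass hm (by linarith) hθ0 hθ hfull hκ
  have hsupp : massSupport (survivorMass ω l θ) = symbolicSurvivorSet ω := by
    ext d
    rw [mem_symbolicSurvivorSet_iff (by omega)]
    refine forall_congr' fun n => ⟨fun h => ?_, fun h => ?_⟩
    · by_contra hn
      exact h (if_neg hn)
    · exact (hκ0.trans_le (hlow _ h)).ne'
  have hκ1 : κ ≤ 1 := (hlow [] trivial).trans (hmass.le_one [])
  have := hmass.isAhlforsRegular_image hb hl hκ0 hκ1 (by
    rw [hsupp]
    exact isClosed_symbolicSurvivorSet ω)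
  rwa [hsupp] at this

/-! ### The two overlap conditions -/

theorem PartialMatch.exists_prefixWord {j : ℕ} {w : List (Fin b)} (hb : 0 < b)
    (h : PartialMatch ω j w) : ∃ d k, w = prefixWord d (k + j) := by
  obtain ⟨d, hd⟩ := exists_prefixWord_eq hb w
  exact ⟨d, w.length - j, by rw [Nat.sub_add_cancel h.le_length, hd]⟩

/-- The last `j` letters of a completed `ω^k` are its suffix, which the hypothesis with shift `m -
j` identifies with the first `j` letters of `ω^(k+m-j)`. -/
theorem ProgressivelyOverlapping.partialMatch (hω : ProgressivelyOverlapping ω) (hb : 0 < b)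
    {w : List (Fin b)} (hw : PartialMatch ω m w) {j : ℕ} (hj : 1 ≤ j) (hjm : j < m) :
    PartialMatch ω j w := by
  obtain ⟨d, k, rfl⟩ := hw.exists_prefixWord hb
  rw [partialMatch_prefixWord_iff le_rfl] at hw
  obtain ⟨i, rfl⟩ := Nat.exists_eq_add_of_le hjm.le
  rw [show k + (j + i) = k + i + j by omega, partialMatch_prefixWord_iff hjm.le]
  intro t ht
  have := hω (k + i) (by omega) i (by omega) (by omega) t (by omega)
  rw [this]
  simp only [Nat.add_sub_cancel]
  rw [← hw (t + i) (by omega)]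
  congr 1
  omega

theorem TotallyDistinct.not_partialMatch (hω : TotallyDistinct ω) (hb : 0 < b)
    {w : List (Fin b)} (hw : PartialMatch ω m w) {j : ℕ} (hj : 1 ≤ j) (hjm : j < m) :
    ¬ PartialMatch ω j w := by
  obtain ⟨d, k, rfl⟩ := hw.exists_prefixWord hb
  rw [partialMatch_prefixWord_iff le_rfl] at hw
  obtain ⟨i, rfl⟩ := Nat.exists_eq_add_of_le hjm.le
  rw [show k + (j + i) = k + i + j by omega, partialMatch_prefixWord_iff hjm.le]
  intro hmatch
  refine hω (k + i) (by omega) i (by omega) (by omega) fun t ht => ?_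
  rw [← hmatch t (by omega)]
  simp only [Nat.add_sub_cancel]
  rw [← hw (t + i) (by omega)]
  congr 1
  omega

theorem sum_inv_pow_sub (l θ : ℝ) (M : ℕ) :
    ∑ i ∈ Finset.range M, θ * (l ^ (M - i))⁻¹ = θ * ∑ i ∈ Finset.range M, (l⁻¹) ^ (i + 1) := by
  rw [← Finset.mul_sum, ← Finset.sum_range_reflect fun i => (l⁻¹) ^ (i + 1)]
  congr 1
  refine Finset.sum_congr rfl fun i hi => ?_
  have := Finset.mem_range.1 hi
  rw [inv_pow, show M - 1 - i + 1 = M - i by omega]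

theorem ProgressivelyOverlapping.isAhlforsRegular (hb : 3 ≤ b) (hm : 2 ≤ m)
    (hω : ProgressivelyOverlapping ω) {l : ℝ} (hl1 : (b : ℝ) - 1 < l)
    (hl : l ^ m - ((b : ℝ) - 1) * ∑ i ∈ Finset.range m, l ^ i = 0) :
    IsAhlforsRegular (Real.log l / Real.log b) (survivorSet ω) := by
  have hb' : (3 : ℝ) ≤ b := by exact_mod_cast hb
  have hl0 : 0 < l := by linarith
  have hθ0 : 0 < ((b : ℝ) - 1) * l⁻¹ := mul_pos (by linarith) (by positivity)
  -- This is the equation of `l` divided by `l^m`. It gives both the weight at a complete hole and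
  -- the lower bound `κ = θ`.
  have hsum : ((b : ℝ) - 1) * l⁻¹ = 1 - ∑ i ∈ Finset.range (m - 1),
      ((b : ℝ) - 1) * l⁻¹ * (l ^ (m - 1 - i))⁻¹ := by
    obtain ⟨M, rfl⟩ : ∃ M, m = M + 1 := ⟨m - 1, by omega⟩
    rw [Nat.add_sub_cancel]
    have hterm : ∀ i ∈ Finset.range M,
        ((b : ℝ) - 1) * l⁻¹ * (l ^ (M - i))⁻¹ = (l ^ (M + 1))⁻¹ * (((b : ℝ) - 1) * l ^ i) := by
      intro i hi
      have hi := Finset.mem_range.1 hi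
      rw [show M + 1 = M - i + i + 1 by omega, pow_succ, pow_add]
      field_simp
    rw [Finset.sum_congr rfl hterm, ← Finset.mul_sum, ← Finset.mul_sum]
    rw [Finset.sum_range_succ] at hl
    have : ((b : ℝ) - 1) * ∑ i ∈ Finset.range M, l ^ i = l ^ (M + 1) - (b - 1) * l ^ M := by
      linarith
    rw [this, pow_succ]
    field_simp
    ring
  refine isAhlforsRegular_survivorSet (θ := ((b : ℝ) - 1) * l⁻¹) (κ := ((b : ℝ) - 1) * l⁻¹)
    (by omega) hm (by linarith) hθ0 ?_ (fun w hw => ?_) hθ0 hsum.le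
  · have h := pow_sub_geom_sum_mul (b : ℝ) l m
    rw [hl, zero_mul] at h
    obtain ⟨M, rfl⟩ : ∃ M, m = M + 1 := ⟨m - 1, by omega⟩
    rw [Nat.add_sub_cancel]
    rw [pow_succ, pow_succ] at h
    field_simp
    linarith
  · conv_rhs => rw [hsum]
    rw [survivalWeight]
    congr 1
    refine Finset.sum_congr rfl fun i hi => if_pos ?_
    have := Finset.mem_range.1 hi
    exact hω.partialMatch (by omega) hw (by omega) (by omega)

theorem TotallyDistinct.isAhlforsRegular (hb : 3 ≤ b) (hm : 2 ≤ m)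
    (hω : TotallyDistinct ω) {l : ℝ} (hl1 : (b : ℝ) - 1 < l)
    (hl : l ^ m - (b : ℝ) * l ^ (m - 1) + 1 = 0) :
    IsAhlforsRegular (Real.log l / Real.log b) (survivorSet ω) := by
  have hb' : (3 : ℝ) ≤ b := by exact_mod_cast hb
  have hl0 : 0 < l := by linarith
  -- `(l - 1)⁻¹` is the full geometric series `∑ l^(-i)`, `i ≥ 1`; it is below `1` because `l > b -
  -- 1 ≥ 2`.
  refine isAhlforsRegular_survivorSet (θ := 1) (κ := 1 - (l - 1)⁻¹)
    (by omega) hm (by linarith) one_pos ?_ (fun w hw => ?_) ?_ ?_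
  · obtain ⟨M, rfl⟩ : ∃ M, m = M + 1 := ⟨m - 1, by omega⟩
    rw [Nat.add_sub_cancel] at *
    rw [pow_succ] at hl
    field_simp
    linarith
  · rw [survivalWeight, Finset.sum_eq_zero, sub_zero]
    intro i hi
    have := Finset.mem_range.1 hi
    exact if_neg (hω.not_partialMatch (by omega) hw (by omega) (by omega))
  · exact sub_pos.2 (inv_lt_one_of_one_lt₀ (by linarith))
  · rw [sum_inv_pow_sub, one_mul]
    refine sub_le_sub_left ?_ 1
    simp only [pow_succ]
    rw [← Finset.sum_mul]
    have h1 : l⁻¹ < 1 := inv_lt_one_of_one_lt₀ (by linarith)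
    have h2 := geom_sum_mul l⁻¹ (m - 1)
    have h3 : 0 ≤ (l⁻¹) ^ (m - 1) := by positivity
    have h4 : l * l⁻¹ = 1 := mul_inv_cancel₀ hl0.ne'
    rw [← one_div (l - 1), le_div_iff₀ (by linarith)]
    calc _ = (∑ i ∈ Finset.range (m - 1), l⁻¹ ^ i) * (l * l⁻¹ - l⁻¹) := by ring
      _ ≤ 1 := by rw [h4]; linarith

end Holes

theorem theorem1p4 (b m : ℕ) (hb : 3 ≤ b) (hm : 2 ≤ m) :
    (∃ l : ℝ,
      ((b : ℝ) - 1 < l ∧ l < b ∧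
        l ^ m - ((b : ℝ) - 1) * ∑ i ∈ Finset.range m, l ^ i = 0 ∧
        IsPisot l ∧
        ∀ x : ℝ, (b : ℝ) - 1 < x → x < b →
          x ^ m - ((b : ℝ) - 1) * ∑ i ∈ Finset.range m, x ^ i = 0 → x = l) ∧
      ∀ ω : ℕ → Fin m → Fin b, ProgressivelyOverlapping ω →
        IsAhlforsRegular (Real.log l / Real.log b) (survivorSet ω)) ∧
    (∃ η : ℝ,
      ((b : ℝ) - 1 < η ∧ η < b ∧
        η ^ m - (b : ℝ) * η ^ (m - 1) + 1 = 0 ∧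
        IsPisot η ∧
        ∀ x : ℝ, (b : ℝ) - 1 < x → x < b →
          x ^ m - (b : ℝ) * x ^ (m - 1) + 1 = 0 → x = η) ∧
      ∀ ω : ℕ → Fin m → Fin b, TotallyDistinct ω →
        IsAhlforsRegular (Real.log η / Real.log b) (survivorSet ω)) := by
  obtain ⟨l, hl⟩ := exists_geom_pisot_root hb hm
  obtain ⟨η, hη⟩ := exists_trinomial_pisot_root hb hm
  exact ⟨⟨l, hl, fun ω hω => hω.isAhlforsRegular hb hm hl.1 hl.2.2.1⟩,
    ⟨η, hη, fun ω hω => hω.isAhlforsRegular hb hm hη.1 hη.2.2.1⟩⟩
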